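/- **Setting.** Let $p$ be an odd prime, let $m, r_1,\dots,r_t$ be positive integers with $m\mid r_j$ for all $j$, and suppose that $r=\sum_j r_j\ge 4$ is even and $m\le r/2$. Put $V=\mathbb F_{p^{r_1}}\times\cdots\times\mathbb F_{p^{r_t}}$ with $\langle a,b\rangle=\sum_j \mathrm{Tr}_1^{r_j}(a_jb_j)$, and $\langle a,b\rangle=\mathrm{Tr}_1^m(ab)$ on $\mathbb F_{p^m}$, where $\mathrm{Tr}_a^b$ is the trace from $\mathbb F_{p^b}$ to $\mathbb F_{p^a}$. For $f:V\to\mathbb F_p$ let $W_f(a)=\sum_{x\in V}\zeta_p^{f(x)-\langle a,x\rangle}$ with $\zeta_p=e^{2\pi i/p}$; $f$ is bent if $|W_f(a)|=p^{r/2}$ for all $a\in V$, and then (as $r$ is even) $W_f(a)=\pm p^{r/2}\zeta_p^{f^*(a)}$ for a function $f^*:V\to\mathbb F_p$, the dual of $f$. For $F:V\to\mathbb F_{p^m}$ and $c\in\mathbb F_{p^m}^*$ put $F_c(x)=\mathrm{Tr}_1^m(cF(x))$; $F$ is vectorial bent if all $F_c$, $c\neq0$, are bent. Let $F:V\to\mathbb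 F_{p^m}$ satisfy Condition A with sign $\varepsilon\in\{1,-1\}$: $F$ is vectorial bent, $F(0)=0$, $F(-x)=F(x)$, $W_{F_c}(a)=\varepsilon p^{r/2}\zeta_p^{(F_c)^*(a)}$ for all $c\in\mathbb F_{p^m}^*$ and $a\in V$, and there are a vectorial bent function $F^*:V\to\mathbb F_{p^m}$ and a positive integer $e$ with $\gcd(e,p^m-1)=1$ such that $(F_c)^*=(F^*)_{c^{-e}}$ and $F^*(cx)=c^{e+1}F^*(x)$ for all $c\in\mathbb F_{p^m}^*$, $x\in V$. Let $s_1,s_2$ be positive integers with $s_1\mid s_2\mid m$, $s_1+s_2\le r/2$, and $s_1+s_2\ne r/2$ if $\varepsilon=-1$. Let $\lambda\in\mathbb F_{p^m}^*$ and $D=\{x\in V\setminus\{0\}:\mathrm{Tr}_{s_2}^m(\lambda F(x))=0\}$. For $E\subseteq V$ let $$\mathcal C_E=\Big\{\Big(\sum_{j=1}^t \mathrm{Tr}_{s_1}^{r_j}(\alpha_jd_j)\Big)_{d\in E}:\alpha\in V\Big\},$$ a linear code over $\mathbb F_{p^{s_1}}$, and let $d^\perp$ denote the minimum distance of the dual code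 $\mathcal C_E^\perp$ (for the standard inner product). **Secret sharing.** Number the coordinates of $\mathcal C_E$ by $0,\dots,n-1$ (in any order), and let $G=[g_0,\dots,g_{n-1}]$ be a generator matrix of $\mathcal C_E$ and $H=[h_0,\dots,h_{n-1}]$ one of $\mathcal C_E^\perp$. In the secret sharing scheme based on $\mathcal C_E^\perp$ the dealer chooses a vector $u$ over $\mathbb F_{p^{s_1}}$; the secret is $uh_0$ and the participant $P_i$ ($1\le i\le n-1$) receives the share $uh_i$. A set of participants is an access set if its shares determine the secret, and a minimal access set if moreover no proper subset of it is an access set. **Proposition.** (1) For $\mathcal C=\mathcal C_D$: $d^\perp=2$, and the secret sharing scheme based on $\mathcal C^\perp$ has exactly $p^{r-s_1}$ minimal access sets. For $1\le i\le n-1$, if $g_i$ is a multiple of $g_0$, then $P_i$ is in every minimal access set; if $g_i$ is not a multiple of $g_0$, then $P_i$ is in exactly $(p^{s_1}-1)p^{r-2s_1}$ of the $p^{r-s_1}$ minimal access sets. (2) Suppose in addition that there is a positive integer $h$ such that $F(cx)=c^hF(x)$ for all $c\in\mathbb F_{p^m}^*$, $x\in V$, and let $\widetilde D=\{w_1,\dots,w_u\}\subseteq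 D$ be such that $D$ is the disjoint union of the sets $w_i\mathbb F_{p^{s_1}}^*$, $1\le i\le u$. For $\mathcal C=\mathcal C_{\widetilde D}$: $d^\perp\ge3$, and the secret sharing scheme based on $\mathcal C^\perp$ has exactly $p^{r-s_1}$ minimal access sets. For every $l$ with $1\le l\le\min\{\frac r{s_1}-1,\,d^\perp-2\}$, every set of $l$ participants is contained in exactly $p^{r-s_1(l+1)}(p^{s_1}-1)^l$ of the $p^{r-s_1}$ minimal access sets. -/

import Mathlib

open scoped Matrix

noncomputable section

namespace BentCode

/-! ### Bent functions

`V` and `W` are finite vector spaces over `𝔽_p`, given with pairings `BV`, `BW` (their inner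
products); `r` is the dimension of `V` over `𝔽_p`. -/

section Bent

variable (p : ℕ) [Fact p.Prime] (r : ℕ) {V W : Type*} [Fintype V] [Zero W]
  (BV : V → V → ZMod p) (BW : W → W → ZMod p)

/-- The Walsh transform `W_f(a) = ∑_{x ∈ V} ζ_p ^ (f(x) - ⟨a, x⟩)`, with `ζ_p = exp(2πi/p)`. -/
def walsh (f : V → ZMod p) (a : V) : ℂ :=
  ∑ x : V, ZMod.stdAddChar (f x - BV a x)

/-- `f` is bent: `|W_f(a)| = p^{r/2}` for all `a`. -/
def IsBent (f : V → ZMod p) : Prop :=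
  ∀ a : V, ‖walsh p BV f a‖ = √((p : ℝ) ^ r)

/-- `g` is the dual of the bent function `f`: `W_f(a) = ± p^{r/2} ζ_p^{g(a)}` if `p ≡ 1 mod 4`
or `r` is even, and `W_f(a) = ± i p^{r/2} ζ_p^{g(a)}` otherwise (the sign may depend on `a`). -/
def IsBentDual (f g : V → ZMod p) : Prop :=
  IsBent p r BV f ∧ ∀ a : V, ∃ u : ℂ,
    ((p % 4 = 1 ∨ Even r) → u = 1 ∨ u = -1) ∧
    (¬ (p % 4 = 1 ∨ Even r) → u = Complex.I ∨ u = -Complex.I) ∧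
    walsh p BV f a = u * (√((p : ℝ) ^ r) : ℝ) * ZMod.stdAddChar (g a)

/-- `f` is a weakly regular bent function with constant `ε_f = ε`. -/
def IsWeaklyRegular (f : V → ZMod p) (ε : ℂ) : Prop :=
  ∃ g : V → ZMod p, IsBentDual p r BV f g ∧
    ∀ a : V, walsh p BV f a = ε * (√((p : ℝ) ^ r) : ℝ) * ZMod.stdAddChar (g a)

/-- The component function `F_c(x) = ⟨c, F(x)⟩`. -/
def component (F : V → W) (c : W) : V → ZMod p :=
  fun x => BW c (F x)

/-- `F` is vectorial bent: all `F_c` with `c ≠ 0` are bent. -/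
def IsVectorialBent (F : V → W) : Prop :=
  ∀ c : W, c ≠ 0 → IsBent p r BV (component p BW F c)

/-- `F` is vectorial dual-bent, with vectorial dual `G` and permutation `σ` of `W \ {0}`:
both are vectorial bent and `(F_c)^* = G_{σ(c)}` for all `c ≠ 0`. -/
def IsVectorialDual (F G : V → W) (σ : Equiv.Perm {c : W // c ≠ 0}) : Prop :=
  IsVectorialBent p r BV BW F ∧ IsVectorialBent p r BV BW G ∧
    ∀ c : {c : W // c ≠ 0},
      IsBentDual p r BV (component p BW F c) (component p BW G (σ c))

end Bent

/-! ### Condition A -/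

section ConditionA

variable (p : ℕ) [Fact p.Prime]

/-- The inner product `⟨a, b⟩ = Tr(ab)` of a finite field over `𝔽_p`. -/
def fieldPairing (M : Type*) [Field M] [Algebra (ZMod p) M] (a b : M) : ZMod p :=
  Algebra.trace (ZMod p) M (a * b)

/-- The inner product `⟨a, b⟩ = ∑_j Tr(a_j b_j)` of `V = ∏_j R_j` over `𝔽_p`. -/
def prodPairing {t : ℕ} (R : Fin t → Type*) [∀ j, Field (R j)] [∀ j, Algebra (ZMod p) (R j)]
    (a b : ∀ j, R j) : ZMod p :=
  ∑ j, fieldPairing p (R j) (a j) (b j)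

/-- Condition A for `F : ∏_j 𝔽_{p^{r_j}} → 𝔽_{p^m}`, with sign `ε`. Here `M` plays the role of
`𝔽_{p^m}`, `R j` that of `𝔽_{p^{r_j}}`, and `r = ∑_j r_j`. -/
structure ConditionA (m : ℕ) {t : ℕ} (rs : Fin t → ℕ) {M : Type*} [Field M] [Fintype M]
    [Algebra (ZMod p) M] {R : Fin t → Type*} [∀ j, Field (R j)] [∀ j, Fintype (R j)]
    [∀ j, Algebra (ZMod p) (R j)] [∀ j, Algebra M (R j)]
    (F : (∀ j, R j) → M) (ε : ℤ) : Prop where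
  odd_p : Odd p
  m_pos : 0 < m
  rs_pos : ∀ j, 0 < rs j
  four_le : 4 ≤ ∑ j, rs j
  even_r : Even (∑ j, rs j)
  m_le : m ≤ (∑ j, rs j) / 2
  m_dvd : ∀ j, m ∣ rs j
  card_M : Fintype.card M = p ^ m
  card_R : ∀ j, Fintype.card (R j) = p ^ rs j
  map_zero : F 0 = 0
  map_neg : ∀ x, F (-x) = F x
  sign : ε = 1 ∨ ε = -1
  weaklyRegular : ∀ c : M, c ≠ 0 →
    IsWeaklyRegular p (∑ j, rs j) (prodPairing p R) (component p (fieldPairing p M) F c) (ε : ℂ)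
  dual : ∃ (Fs : (∀ j, R j) → M) (e : ℕ) (σ : Equiv.Perm {c : M // c ≠ 0}),
    0 < e ∧ Nat.gcd e (p ^ m - 1) = 1 ∧
    IsVectorialDual p (∑ j, rs j) (prodPairing p R) (fieldPairing p M) F Fs σ ∧
    (∀ c : {c : M // c ≠ 0}, (σ c : M) = ((c : M) ^ e)⁻¹) ∧
    (∀ c : M, c ≠ 0 → ∀ x, Fs (c • x) = c ^ (e + 1) * Fs x)

end ConditionA

/-! ### Linear codes

A code of length `n` over `K` is a subspace of `ι → K`, where `ι` is an index set of size `n`. -/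

section Codes

variable {K : Type*} [Field K] {ι : Type*} [Fintype ι]

/-- The dual code `C^⊥` for the standard inner product. -/
def dualCode (C : Submodule K (ι → K)) : Submodule K (ι → K) where
  carrier := {u | ∀ v ∈ C, u ⬝ᵥ v = 0}
  add_mem' := by
    intro a b ha hb v hv
    rw [add_dotProduct, ha v hv, hb v hv, add_zero]
  zero_mem' := by
    intro v _
    exact zero_dotProduct v
  smul_mem' := by
    intro c a ha v hv
    rw [smul_dotProduct, ha v hv, smul_zero]

open Classical in
/-- The minimum distance: the least Hamming weight of a nonzero codeword. -/
def minDist (C : Submodule K (ι → K)) : ℕ :=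
  sInf {w | ∃ c ∈ C, c ≠ 0 ∧ hammingNorm c = w}

/-- `G` is a generator matrix of `C`: its rows form a basis of `C`. -/
def IsGeneratorMatrix {k : ℕ} (G : Matrix (Fin k) ι K) (C : Submodule K (ι → K)) : Prop :=
  LinearIndependent K G.row ∧ Submodule.span K (Set.range G.row) = C

end Codes

/-! ### Secret sharing schemes -/

section SecretSharing

variable {K : Type*} [Field K] {ι : Type*} [Fintype ι]

/-- The participants: all coordinates except the one, `i₀`, which carries the secret. -/
abbrev Participant (i₀ : ι) : Type _ := {i : ι // i ≠ i₀}

/-- In the scheme given by the generator matrix `H`, the dealer chooses a vector `u`; the secret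
is the coordinate `i₀` of `u H`, and the participant `i` receives the coordinate `i` of `u H`.
A set `A` of participants is an access set if the secret can be computed from the shares in `A`. -/
def IsAccessSet {k : ℕ} (H : Matrix (Fin k) ι K) (i₀ : ι) (A : Finset (Participant i₀)) : Prop :=
  ∃ recover : (A → K) → K, ∀ u : Fin k → K,
    recover (fun i => (u ᵥ* H) i.1.1) = (u ᵥ* H) i₀

/-- A minimal access set: an access set no proper subset of which is an access set. -/
def IsMinimalAccessSet {k : ℕ} (H : Matrix (Fin k) ι K) (i₀ : ι)
    (A : Finset (Participant i₀)) : Prop :=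
  IsAccessSet H i₀ A ∧ ∀ B : Finset (Participant i₀), B ⊂ A → ¬ IsAccessSet H i₀ B

/-- The number of minimal access sets that contain the set `T` of participants. -/
def numMinimalAccessSets {k : ℕ} (H : Matrix (Fin k) ι K) (i₀ : ι)
    (T : Finset (Participant i₀)) : ℕ :=
  Set.ncard {A : Finset (Participant i₀) | IsMinimalAccessSet H i₀ A ∧ T ⊆ A}

end SecretSharing

/-! ### The codes -/

section Construction

variable {t : ℕ} {R : Fin t → Type*} [∀ j, Field (R j)]

open Classical in
/-- `D(F) = {x ∈ V \ {0} : Tr(lam * F(x)) = 0}`, with the trace from `M` to `K₂`. -/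
def defSet [∀ j, Fintype (R j)] (K₂ : Type*) {M : Type*} [Field K₂] [Field M] [Algebra K₂ M]
    (F : (∀ j, R j) → M) (lam : M) : Finset (∀ j, R j) :=
  {x | x ≠ 0 ∧ Algebra.trace K₂ M (lam * F x) = 0}

/-- `c_α = (∑_j Tr(α_j d_j))_{d ∈ D}`, with the traces from `R j` to `K₁`; linear in `α`. -/
def codeword (K₁ : Type*) [Field K₁] [∀ j, Algebra K₁ (R j)] (D : Finset (∀ j, R j)) :
    (∀ j, R j) →ₗ[K₁] (D → K₁) where
  toFun α := fun d => ∑ j, Algebra.trace K₁ (R j) (α j * d.1 j)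
  map_add' := by
    intro a b
    funext d
    simp [add_mul, Finset.sum_add_distrib]
  map_smul' := by
    intro c a
    funext d
    simp [Finset.mul_sum]

/-- The code `C_D = {c_α : α ∈ V}`. -/
def code (K₁ : Type*) [Field K₁] [∀ j, Algebra K₁ (R j)] (D : Finset (∀ j, R j)) :
    Submodule K₁ (D → K₁) :=
  LinearMap.range (codeword K₁ D)

/-- `Dt = {w_1, …, w_u}` is such that `D` is the disjoint union of the sets `w_i K₁^*`. -/
def IsProjectiveSystem (K₁ : Type*) [Field K₁] [∀ j, Algebra K₁ (R j)]
    (D Dt : Finset (∀ j, R j)) : Prop :=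
  Dt ⊆ D ∧ (D : Set (∀ j, R j)) = ⋃ w ∈ Dt, {x | ∃ c : K₁, c ≠ 0 ∧ x = c • w} ∧
    ∀ w ∈ Dt, ∀ w' ∈ Dt, w ≠ w' →
      Disjoint {x | ∃ c : K₁, c ≠ 0 ∧ x = c • w} {x | ∃ c : K₁, c ≠ 0 ∧ x = c • w'}

end Construction

end BentCode

end

open BentCode

open scoped Matrix

namespace BentCode

/-! Access sets of the scheme based on the dual code are governed by words of `C` with coordinate
`1` at the secret. If such words are equal as soon as their supports are nested, they correspond
bijectively to the minimal access sets. Those containing a set `T` of `l` participants come from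
words with no zero on `T`. When no nonzero dual word lives on `T` and the secret, `C` projects onto
these `l + 1` coordinates, and with `q` the order of the base field the count is `(q - 1) ^ l * |C|
/ q ^ (l + 1)` (`numMinimalAccessSets_mul`). Dual words are linear relations among the elements of
the defining set (`mem_dualCode_code_iff`), which settles small weights.

The arithmetic content is `separates_defSet`: if `α` is not a multiple of `β`, some point of `D` is
orthogonal to `β` but not to `α`. Otherwise the spans `U` of `β` and `U'` of `α, β` would have
equally many zeros of `Tr(lam * F)` in their orthogonals. Character sums express these numbers
through the zeros in `U` and `U'` of a trace of the dual function (`card_zeros_inter_orthogonal`),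
and a direct estimate shows that the number for `U'` is strictly smaller (`zeros_lt_zeros`). The
estimate needs the dual function to vanish at `0`; this follows from evenness of `F` by reduction
modulo `2` (`eq_zero_of_sum_eq`). -/

theorem mem_range_vecMul_iff {K ι : Type*} [Field K]
    {C : Submodule K (ι → K)} {k : ℕ} {H : Matrix (Fin k) ι K}
    (hH : IsGeneratorMatrix H C) (v : ι → K) : (∃ u : Fin k → K, u ᵥ* H = v) ↔ v ∈ C := by
  rw [← hH.2]
  have h := range_vecMulLinear H
  rw [show Submodule.span K (Set.range H.row) = LinearMap.range H.vecMulLinear from h.symm]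
  rfl

/-- A generator matrix sees the same linear relations between two coordinates as the code. -/
theorem col_eq_smul_iff {K ι : Type*} [Field K]
    {C : Submodule K (ι → K)} {k : ℕ} {G : Matrix (Fin k) ι K}
    (hG : IsGeneratorMatrix G C) (i j : ι) (a : K) :
    G.col i = a • G.col j ↔ ∀ c ∈ C, c i = a * c j := by
  classical
  constructor
  · intro h c hc
    obtain ⟨u, rfl⟩ := (mem_range_vecMul_iff hG c).2 hc
    change u ⬝ᵥ G.col i = a * (u ⬝ᵥ G.col j)
    rw [h, dotProduct_smul, smul_eq_mul]
  · intro h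
    funext l
    exact h (G l) (hG.2 ▸ Submodule.subset_span ⟨l, rfl⟩)

/-! ### Dual codes, access sets and their enumeration. -/

section CodingTheory

variable {K : Type*} [Field K] {ι : Type*} [Fintype ι]

/-- `C` contains its double dual: a vector orthogonal to `C^⊥` lies in `C`. -/
theorem mem_of_forall_dualCode {C : Submodule K (ι → K)} {x : ι → K}
    (h : ∀ u ∈ dualCode C, u ⬝ᵥ x = 0) : x ∈ C := by
  classical
  by_contra hx
  obtain ⟨f, hf, hC⟩ := Submodule.exists_le_ker_of_notMem hx
  have hfu : ∀ y, f y = (fun i => f (Pi.single i 1)) ⬝ᵥ y := by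
    intro y
    conv_lhs => rw [pi_eq_sum_univ' y, map_sum]
    simp only [map_smul, dotProduct, smul_eq_mul]
    exact Finset.sum_congr rfl fun i _ => mul_comm _ _
  apply hf
  rw [hfu]
  refine h _ fun v hv => ?_
  rw [← hfu]
  exact hC hv

/-- If no nonzero word of the dual code is supported in `S`, then `C` projects onto `S → K`. -/
theorem restrict_surjective {C : Submodule K (ι → K)} {S : Finset ι}
    (hS : ∀ u ∈ dualCode C, (∀ i ∉ S, u i = 0) → u = 0) :
    Function.Surjective ((LinearMap.funLeft K K (Subtype.val : S → ι)).comp C.subtype) := by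
  classical
  set φ := (LinearMap.funLeft K K (Subtype.val : S → ι)).comp C.subtype
  intro y
  refine mem_of_forall_dualCode (C := LinearMap.range φ) fun u hu => ?_
  let v : ι → K := fun i => if h : i ∈ S then u ⟨i, h⟩ else 0
  have hv : ∀ w : ι → K, v ⬝ᵥ w = u ⬝ᵥ (fun i : S => w i) := by
    intro w
    simp only [dotProduct]
    rw [← Finset.sum_subset (Finset.subset_univ S), ← Finset.sum_coe_sort S]
    · exact Finset.sum_congr rfl fun i _ => by simp [v]
    · intro i _ hi
      simp [v, hi]
  have h0 : v = 0 := by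
    refine hS v (fun c hc => ?_) fun i hi => by simp [v, hi]
    rw [hv]
    exact hu _ ⟨⟨c, hc⟩, rfl⟩
  have : u = 0 := by
    funext i
    have := congrFun h0 i.1
    simpa [v] using this
  rw [this, zero_dotProduct]

/-- The fibres of a surjective linear map all have the cardinality of the kernel. -/
theorem card_preimage_mul {A B : Type*} [AddCommGroup A] [Module K A] [AddCommGroup B]
    [Module K B] [Finite A] (φ : A →ₗ[K] B) (hφ : Function.Surjective φ)
    (X : Set B) : (φ ⁻¹' X).ncard * Nat.card B = X.ncard * Nat.card A := by
  classical
  have hB : Finite B := Finite.of_surjective φ hφ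
  have hfib : ∀ b : B, Nat.card {a // φ a = b} = Nat.card {a // φ a = 0} := by
    intro b
    obtain ⟨a₀, rfl⟩ := hφ b
    refine Nat.card_congr ⟨fun a => ⟨a.1 - a₀, by rw [map_sub, a.2, sub_self]⟩,
      fun a => ⟨a.1 + a₀, by rw [map_add, a.2, zero_add]⟩, fun a => by simp, fun a => by simp⟩
  have hpre : ∀ Y : Set B, (φ ⁻¹' Y).ncard = Y.ncard * Nat.card {a // φ a = 0} := by
    intro Y
    rw [← Nat.card_coe_set_eq, ← Nat.card_coe_set_eq,
      Nat.card_congr (Equiv.sigmaFiberEquiv (fun a : φ ⁻¹' Y => (⟨φ a.1, a.2⟩ : Y))).symm]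
    have hy : ∀ y : Y, Nat.card {a : φ ⁻¹' Y // (⟨φ a.1, a.2⟩ : Y) = y}
        = Nat.card {a // φ a = 0} := by
      intro y
      rw [← hfib y.1]
      exact Nat.card_congr ⟨fun a => ⟨a.1.1, congrArg Subtype.val a.2⟩,
        fun a => ⟨⟨a.1, by rw [Set.mem_preimage, a.2]; exact y.2⟩, Subtype.ext a.2⟩,
        fun a => rfl, fun a => rfl⟩
    have := Fintype.ofFinite Y
    rw [Nat.card_sigma]
    simp [hy, Nat.card_eq_fintype_card]
  have huniv := hpre Set.univ
  rw [Set.preimage_univ, Set.ncard_univ, Set.ncard_univ] at huniv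
  rw [hpre X, huniv]
  ring

/-- A set of participants is an access set iff `C` has a word with coordinate `1` at the secret
and otherwise supported in the set. -/
theorem isAccessSet_iff {C : Submodule K (ι → K)} {k : ℕ} {H : Matrix (Fin k) ι K}
    (hH : IsGeneratorMatrix H (dualCode C)) (i₀ : ι) (A : Finset (Participant i₀)) :
    IsAccessSet H i₀ A ↔
      ∃ c ∈ C, c i₀ = 1 ∧ ∀ i : Participant i₀, c i.1 ≠ 0 → i ∈ A := by
  classical
  constructor
  · rintro ⟨f, hf⟩
    -- Recovery need not be linear, but the dealer's vector `0` has zero shares and secret `0`, so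
    -- zero shares on `A` force the secret `0`.
    have hvan : ∀ v ∈ dualCode C, (∀ i ∈ A, v i.1 = 0) → v i₀ = 0 := by
      intro v hv hA
      obtain ⟨u, rfl⟩ := (mem_range_vecMul_iff hH v).2 hv
      have h0 := hf 0
      rw [← hf u]
      simp only [Matrix.zero_vecMul, Pi.zero_apply] at h0
      rw [← h0]
      congr 1
      funext i
      exact hA i.1 i.2
    let E : Submodule K (ι → K) :=
      { carrier := {x | ∀ i, x i ≠ 0 → ∃ h : i ≠ i₀, (⟨i, h⟩ : Participant i₀) ∈ A}
        add_mem' := by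
          intro a b ha hb i hi
          by_cases h : a i = 0
          · exact hb i fun h' => hi (by simp [h, h'])
          · exact ha i h
        zero_mem' := fun i hi => absurd rfl hi
        smul_mem' := by
          intro c a ha i hi
          exact ha i fun h => hi (by simp [h]) }
    -- `E` consists of the vectors supported in `A`. A vector orthogonal to `C` and to `E` is a dual
    -- word vanishing on `A`, hence at `i₀`; by biduality the unit vector at `i₀` lies in `C + E`,
    -- and its `C`-part is the required word.
    have hmem : (Pi.single i₀ 1 : ι → K) ∈ C ⊔ E := by
      refine mem_of_forall_dualCode fun v hv => ?_
      rw [dotProduct_single, mul_one]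
      refine hvan v (fun c hc => hv c (Submodule.mem_sup_left hc)) fun i hi => ?_
      have := hv (Pi.single i.1 1) (Submodule.mem_sup_right fun j hj => ?_)
      · simpa using this
      · obtain rfl : j = i.1 := by
          by_contra hne
          exact hj (Pi.single_eq_of_ne hne _)
        exact ⟨i.2, hi⟩
    obtain ⟨c, hc, a, ha, hca⟩ := Submodule.mem_sup.1 hmem
    refine ⟨c, hc, ?_, fun i hi => ?_⟩
    · have h1 := congrFun hca i₀
      have h2 : a i₀ = 0 := by
        by_contra h
        exact (ha i₀ h).1 rfl
      simpa [h2] using h1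
    · have h1 := congrFun hca i.1
      rw [Pi.add_apply, Pi.single_eq_of_ne i.2] at h1
      have h2 : a i.1 ≠ 0 := fun h => hi (by simpa [h] using h1)
      exact (ha i.1 h2).2
  · rintro ⟨c, hc, h1, hA⟩
    -- Orthogonality of `u H` to `c`, solved for the coordinate `i₀`, where `c` is `1`.
    refine ⟨fun x => -∑ i : A, x i * c i.1.1, fun u => ?_⟩
    have hu := (mem_range_vecMul_iff hH (u ᵥ* H)).1 ⟨u, rfl⟩ c hc
    have hs : (u ᵥ* H) ⬝ᵥ c = (u ᵥ* H) i₀ + ∑ i : A, (u ᵥ* H) i.1.1 * c i.1.1 := by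
      rw [dotProduct, Fintype.sum_eq_add_sum_subtype_ne _ i₀, h1, mul_one,
        Finset.sum_coe_sort A (fun i : Participant i₀ => (u ᵥ* H) i.1 * c i.1),
        Finset.sum_subset (Finset.subset_univ A)]
      intro i _ hi
      rw [not_not.1 (mt (hA i) hi), mul_zero]
    rw [hs] at hu
    exact (eq_neg_of_add_eq_zero_left hu).symm

open Classical in
/-- The support of a word, without the coordinate of the secret. -/
noncomputable def participantSupport (i₀ : ι) (c : ι → K) : Finset (Participant i₀) :=
  {i | c i.1 ≠ 0}

theorem mem_participantSupport {i₀ : ι} {c : ι → K} {i : Participant i₀} :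
    i ∈ participantSupport i₀ c ↔ c i.1 ≠ 0 := by
  simp [participantSupport]

/-- Words of `C` with coordinate `1` at the secret are determined by their supports, in the strong
sense that inclusion of supports implies equality. -/
def IsMinimalAt (C : Submodule K (ι → K)) (i₀ : ι) : Prop :=
  ∀ c ∈ C, ∀ c' ∈ C, c i₀ = 1 → c' i₀ = 1 →
    participantSupport i₀ c ⊆ participantSupport i₀ c' → c = c'

theorem isMinimalAccessSet_iff {C : Submodule K (ι → K)} {k : ℕ} {H : Matrix (Fin k) ι K}
    (hH : IsGeneratorMatrix H (dualCode C)) {i₀ : ι} (hC : IsMinimalAt C i₀)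
    (A : Finset (Participant i₀)) :
    IsMinimalAccessSet H i₀ A ↔ ∃ c ∈ C, c i₀ = 1 ∧ participantSupport i₀ c = A := by
  constructor
  · rintro ⟨hA, hmin⟩
    obtain ⟨c, hc, h1, hcA⟩ := (isAccessSet_iff hH i₀ A).1 hA
    have hsub : participantSupport i₀ c ⊆ A := fun i hi => hcA i (mem_participantSupport.1 hi)
    refine ⟨c, hc, h1, ?_⟩
    by_contra hne
    exact hmin _ (hsub.ssubset_of_ne hne)
      ((isAccessSet_iff hH i₀ _).2 ⟨c, hc, h1, fun i hi => mem_participantSupport.2 hi⟩)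
  · rintro ⟨c, hc, h1, rfl⟩
    refine ⟨(isAccessSet_iff hH i₀ _).2 ⟨c, hc, h1, fun i hi => mem_participantSupport.2 hi⟩, ?_⟩
    intro B hB hacc
    obtain ⟨c', hc', h1', hcB⟩ := (isAccessSet_iff hH i₀ B).1 hacc
    have hsub : participantSupport i₀ c' ⊆ B := fun i hi => hcB i (mem_participantSupport.1 hi)
    obtain rfl := hC c' hc' c hc h1' h1 (hsub.trans hB.1)
    exact hB.2 hsub

/-- Counting the minimal access sets that contain `T`. -/
theorem numMinimalAccessSets_mul [Fintype K] {C : Submodule K (ι → K)} {k : ℕ}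
    {H : Matrix (Fin k) ι K} (hH : IsGeneratorMatrix H (dualCode C)) {i₀ : ι}
    (hC : IsMinimalAt C i₀) (T : Finset (Participant i₀))
    (hT : ∀ u ∈ dualCode C, (∀ i : Participant i₀, i ∉ T → u i.1 = 0) → u = 0) :
    numMinimalAccessSets H i₀ T * Fintype.card K ^ (T.card + 1) =
      (Fintype.card K - 1) ^ T.card * Nat.card C := by
  classical
  let S : Finset ι := insert i₀ (T.map (Function.Embedding.subtype _))
  have hmemS : ∀ i : Participant i₀, i.1 ∈ S ↔ i ∈ T := by
    intro i
    simp [S, i.2]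
  have hnot : i₀ ∉ T.map (Function.Embedding.subtype (fun i => i ≠ i₀)) := by simp
  have hcardS : S.card = T.card + 1 := by
    rw [Finset.card_insert_of_notMem hnot, Finset.card_map]
  set φ := (LinearMap.funLeft K K (Subtype.val : S → ι)).comp C.subtype with hφdef
  have hφ : Function.Surjective φ :=
    restrict_surjective fun u hu h => hT u hu fun i hi => h _ (mt (hmemS i).1 hi)
  -- Admissible values on `S`: `1` at the secret, nonzero on `T`.
  let X : Finset (S → K) :=
    Fintype.piFinset fun i : S => if i.1 = i₀ then {1} else Finset.univ.erase 0
  have hX : X.card = (Fintype.card K - 1) ^ T.card := by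
    rw [Fintype.card_piFinset,
      Finset.prod_coe_sort S (fun i : ι => (if i = i₀ then {1} else Finset.univ.erase (0 : K)).card),
      Finset.prod_insert hnot, Finset.prod_map]
    simp only [if_true, Finset.card_singleton, one_mul]
    rw [Finset.prod_congr rfl (g := fun _ => Fintype.card K - 1), Finset.prod_const]
    intro i _
    rw [Function.Embedding.subtype_apply, if_neg i.2,
      Finset.card_erase_of_mem (Finset.mem_univ _), Finset.card_univ]
  have hmemX : ∀ c : C, φ c ∈ X ↔ c.1 i₀ = 1 ∧ T ⊆ participantSupport i₀ c.1 := by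
    intro c
    simp only [X, Fintype.mem_piFinset]
    constructor
    · intro h
      refine ⟨?_, fun i hi => ?_⟩
      · have := h ⟨i₀, Finset.mem_insert_self _ _⟩
        rwa [if_pos rfl, Finset.mem_singleton] at this
      have := h ⟨i.1, (hmemS i).2 hi⟩
      rw [if_neg i.2] at this
      exact mem_participantSupport.2 (Finset.ne_of_mem_erase this)
    · rintro ⟨h1, h2⟩ ⟨i, hi⟩
      by_cases h : i = i₀
      · subst h
        rw [if_pos rfl]
        exact Finset.mem_singleton.2 h1
      · rw [if_neg h]
        exact Finset.mem_erase.2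
          ⟨mem_participantSupport.1 (h2 ((hmemS ⟨i, h⟩).1 hi)), Finset.mem_univ _⟩
  have himg : {A : Finset (Participant i₀) | IsMinimalAccessSet H i₀ A ∧ T ⊆ A} =
      (fun c : C => participantSupport i₀ c.1) '' (φ ⁻¹' X) := by
    ext A
    simp only [Set.mem_ofPred_eq, isMinimalAccessSet_iff hH hC, Set.mem_image, Set.mem_preimage,
      Finset.mem_coe, hmemX]
    constructor
    · rintro ⟨⟨c, hc, h1, rfl⟩, hT'⟩
      exact ⟨⟨c, hc⟩, ⟨h1, hT'⟩, rfl⟩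
    · rintro ⟨c, ⟨h1, hT'⟩, rfl⟩
      exact ⟨⟨c.1, c.2, h1, rfl⟩, hT'⟩
  have hinj : Set.InjOn (fun c : C => participantSupport i₀ c.1) (φ ⁻¹' X) := by
    intro c hc c' hc' h
    exact Subtype.ext (hC _ c.2 _ c'.2 ((hmemX c).1 hc).1 ((hmemX c').1 hc').1 (le_of_eq h))
  have hcount := card_preimage_mul φ hφ (X : Set (S → K))
  rw [Set.ncard_coe_finset, hX, Nat.card_eq_fintype_card, Fintype.card_fun, Fintype.card_coe,
    hcardS] at hcount
  rw [numMinimalAccessSets, himg, hinj.ncard_image, hcount]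

theorem eq_zero_of_hammingNorm_lt_minDist [DecidableEq K] {C : Submodule K (ι → K)} {u : ι → K}
    (hu : u ∈ C) (h : hammingNorm u < minDist C) : u = 0 := by
  by_contra hne
  refine absurd h (not_lt.2 (Nat.sInf_le ⟨u, hu, hne, ?_⟩))
  congr!

/-- A nonzero word is required because the infimum of the empty set in `ℕ` is `0`. -/
theorem le_minDist [DecidableEq K] {C : Submodule K (ι → K)} {d : ℕ} (hne : ∃ u ∈ C, u ≠ 0)
    (h : ∀ u ∈ C, u ≠ 0 → d ≤ hammingNorm u) : d ≤ minDist C := by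
  obtain ⟨u, hu, h0⟩ := hne
  refine le_csInf ⟨_, u, hu, h0, rfl⟩ ?_
  rintro _ ⟨v, hv, hv0, rfl⟩
  exact (h v hv hv0).trans (le_of_eq (by congr!))

end CodingTheory

theorem ncard_isMinimalAccessSet {K ι : Type*} [Field K] {k : ℕ} (H : Matrix (Fin k) ι K) (i₀ : ι) :
    Set.ncard {A | IsMinimalAccessSet H i₀ A} = numMinimalAccessSets H i₀ ∅ := by
  simp [numMinimalAccessSets]

/-! ### Character sums and signs of Walsh coefficients. -/

section CharacterSums

variable {p : ℕ} [Fact p.Prime]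

/-- Orthogonality of characters; `q` lets the triviality condition be stated in whatever form the
application needs. -/
theorem sum_stdAddChar_comp {A : Type*} [AddCommGroup A] [Fintype A] (g : A →+ ZMod p)
    {q : Prop} [Decidable q] (hq : (∀ a, g a = 0) ↔ q) :
    ∑ a, (ZMod.stdAddChar (g a) : ℂ) = if q then (Fintype.card A : ℂ) else 0 := by
  split_ifs with h <;> rw [← hq] at h
  · simp [h]
  · push Not at h
    obtain ⟨a, ha⟩ := h
    have := AddChar.sum_eq_zero_of_ne_one (ψ := (ZMod.stdAddChar (N := p)).compAddMonoidHom g)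
      (AddChar.ne_one_iff.2 ⟨a, fun h1 => ha ?_⟩)
    · exact this
    · exact ZMod.injective_stdAddChar (h1.trans (AddChar.map_zero_eq_one _).symm)

theorem isIntegral_stdAddChar (k : ZMod p) : IsIntegral ℤ (ZMod.stdAddChar k : ℂ) := by
  refine IsIntegral.of_pow (Nat.Prime.pos Fact.out) (n := p) ?_
  rw [← AddChar.map_nsmul_eq_pow, nsmul_eq_mul, CharP.cast_eq_zero, zero_mul,
    AddChar.map_zero_eq_one]
  exact isIntegral_one

/-- Reduction modulo `2` of the Walsh coefficient at `0` of an even function. -/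
theorem eq_zero_of_sum_eq {V : Type*} [AddCommGroup V] [Fintype V] (hp : Odd p)
    (hV : ∀ x : V, -x = x → x = 0) {f : V → ZMod p} (hf0 : f 0 = 0) (hf : ∀ x, f (-x) = f x)
    {ε : ℤ} (hε : ε = 1 ∨ ε = -1) {P : ℕ} (hP : Odd P) {k : ZMod p}
    (hsum : ∑ x, (ZMod.stdAddChar (f x) : ℂ) = ε * P * ZMod.stdAddChar k) : k = 0 := by
  classical
  by_contra hk
  -- Work modulo `2` in the ring of algebraic integers: the terms of `x` and `-x` cancel and leave
  -- the term `1` of `x = 0`, while the sign and `P` become `1`. So the root of unity `z k` is `1`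
  -- modulo `2`.
  let O := integralClosure ℤ ℂ
  let z : ZMod p → O := fun k => ⟨ZMod.stdAddChar k, isIntegral_stdAddChar k⟩
  have hsumO : ∑ x, z (f x) = ε * P * z k := by
    apply Subtype.ext
    push_cast
    exact hsum
  obtain ⟨Q, _, π, h2, hker⟩ : ∃ (Q : Type) (_ : CommRing Q) (π : O →+* Q),
      (2 : Q) = 0 ∧ ∀ a, π a = 0 → 2 ∣ a := by
    refine ⟨O ⧸ Ideal.span {(2 : O)}, inferInstance, Ideal.Quotient.mk _, ?_, fun a ha =>
      Ideal.mem_span_singleton.1 (Ideal.Quotient.eq_zero_iff_mem.1 ha)⟩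
    rw [← map_ofNat (Ideal.Quotient.mk (Ideal.span {(2 : O)})) 2]
    exact Ideal.Quotient.eq_zero_iff_mem.2 (Ideal.mem_span_singleton_self 2)
  have hdouble : ∀ a : Q, a + a = 0 := fun a => by
    rw [← two_mul, h2, zero_mul]
  have hodd : ∀ n : ℕ, Odd n → (n : Q) = 1 := by
    rintro n ⟨j, rfl⟩
    push_cast
    rw [h2, zero_mul, zero_add]
  have hπε : π ε = 1 := by
    rcases hε with rfl | rfl
    · simp
    · have := hdouble 1
      simp only [Int.cast_neg, Int.cast_one, map_neg, map_one]
      exact (eq_neg_of_add_eq_zero_left this).symm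
  have hz0 : z 0 = 1 := Subtype.ext (AddChar.map_zero_eq_one _)
  have hπk : π (z k) = 1 := by
    have h1 := congrArg π hsumO
    rw [map_mul, map_mul, hπε, map_natCast, hodd P hP, one_mul, one_mul, map_sum,
      ← Finset.add_sum_erase _ _ (Finset.mem_univ (0 : V)), hf0, hz0, map_one] at h1
    rw [← h1, Finset.sum_involution (fun x _ => -x), add_zero]
    · intro x _
      rw [hf]
      exact hdouble _
    · intro x hx _ h
      exact Finset.ne_of_mem_erase hx (hV x h)
    · intro x hx
      exact Finset.mem_erase.2 ⟨neg_ne_zero.2 (Finset.ne_of_mem_erase hx), Finset.mem_univ _⟩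
    · intro x _
      exact neg_neg x
  have hpow : ∀ j : ZMod p, π (z (j * k)) = 1 := by
    intro j
    have : z (j * k) = z k ^ j.val := by
      apply Subtype.ext
      change (ZMod.stdAddChar (j * k) : ℂ) = (ZMod.stdAddChar k : ℂ) ^ j.val
      rw [← AddChar.map_nsmul_eq_pow, nsmul_eq_mul, ZMod.natCast_zmod_val]
    rw [this, map_pow, hπk, one_pow]
  -- As `k ≠ 0`, this is the sum of all `p`-th roots of unity. It vanishes, yet modulo `2` it is
  -- `p`, that is `1`; hence `2` would divide `1`.
  have hzero : ∑ j : ZMod p, z (j * k) = 0 := by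
    apply Subtype.ext
    push_cast
    have hne : (∀ j, AddMonoidHom.mulRight k j = 0) ↔ False :=
      iff_false_intro fun h => hk (by simpa using h 1)
    exact (sum_stdAddChar_comp _ hne).trans (if_neg id)
  have h10 : (1 : Q) = 0 := by
    have h1 := congrArg π hzero
    rw [map_sum, Finset.sum_congr rfl fun j _ => hpow j, map_zero] at h1
    rw [← h1, Finset.sum_const, Finset.card_univ, ZMod.card, nsmul_eq_mul, mul_one, hodd p hp]
  obtain ⟨w, hw⟩ := hker 1 ((map_one π).trans h10)
  have hw' : (1 : ℂ) = 2 * (w : ℂ) := congrArg Subtype.val hw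
  have hint : IsIntegral ℤ (algebraMap ℚ ℂ (1 / 2)) := by
    have : (algebraMap ℚ ℂ (1 / 2)) = (w : ℂ) := by
      simp only [one_div, map_inv₀, map_ofNat]
      exact inv_eq_of_mul_eq_one_right hw'.symm
    rw [this]
    exact w.2
  rw [isIntegral_algebraMap_iff (algebraMap ℚ ℂ).injective] at hint
  obtain ⟨n, hn⟩ := IsIntegrallyClosed.isIntegral_iff.1 hint
  have : (2 * n : ℤ) = 1 := by
    have : (2 * n : ℚ) = 1 := by
      simp only [eq_intCast] at hn
      rw [hn]
      norm_num
    exact_mod_cast this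
  omega

/-- The sign of a Walsh coefficient in front of a root of unity of odd order is well defined. -/
theorem IsBentDual.walsh_eq {V : Type*} [Fintype V] (hp : Odd p) {r : ℕ} (hr : Even r)
    {B : V → V → ZMod p} {f g : V → ZMod p} (hg : IsBentDual p r B f g) {ε : ℤ}
    (hε : ε = 1 ∨ ε = -1) (hf : IsWeaklyRegular p r B f ε) (a : V) :
    walsh p B f a = ε * (p ^ (r / 2) : ℕ) * ZMod.stdAddChar (g a) := by
  obtain ⟨g', -, hg'⟩ := hf
  obtain ⟨u, hu, -, hw⟩ := hg.2 a
  have hsqrt : √((p : ℝ) ^ r) = (p ^ (r / 2) : ℕ) := by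
    obtain ⟨k, rfl⟩ := hr
    rw [← two_mul, Nat.mul_div_cancel_left k two_pos, pow_mul', Real.sqrt_sq (by positivity)]
    push_cast
    rfl
  rw [hg' a, hsqrt, Complex.ofReal_natCast] at hw
  rw [hg' a, hsqrt, Complex.ofReal_natCast]
  have hP : ((p ^ (r / 2) : ℕ) : ℂ) ≠ 0 :=
    Nat.cast_ne_zero.2 (pow_ne_zero _ (Nat.Prime.ne_zero Fact.out))
  have hz : ∀ k : ZMod p, (ZMod.stdAddChar k : ℂ) ^ p = 1 := by
    intro k
    rw [← AddChar.map_nsmul_eq_pow, nsmul_eq_mul, CharP.cast_eq_zero, zero_mul,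
      AddChar.map_zero_eq_one]
  have hpow : ∀ x : ℂ, x = 1 ∨ x = -1 → x ^ p = x := by
    rintro x (rfl | rfl)
    · simp
    · exact hp.neg_one_pow
  have hε' : (ε : ℂ) = 1 ∨ (ε : ℂ) = -1 := by
    rcases hε with rfl | rfl <;> simp
  have heq : (ε : ℂ) * ZMod.stdAddChar (g' a) = u * ZMod.stdAddChar (g a) := by
    apply mul_left_cancel₀ hP
    linear_combination hw
  -- The power `p` kills the roots of unity and, `p` being odd, fixes both signs.
  have h1 := congrArg (· ^ p) heq
  simp only [mul_pow, hz, mul_one] at h1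
  rw [hpow _ hε', hpow _ (hu (Or.inr hr))] at h1
  rw [hw, h1]

end CharacterSums

/-! ### Trace pairings and their compatibility in towers. -/

section Pairing

variable {t : ℕ} {R : Fin t → Type*} [∀ j, Field (R j)]

/-- The bilinear form `∑_j Tr(a_j b_j)` on `∏_j R_j` with values in a common subfield. -/
noncomputable def tracePairing (K : Type*) [Field K] [∀ j, Algebra K (R j)] :
    LinearMap.BilinForm K (∀ j, R j) :=
  ∑ j, (Algebra.traceForm K (R j)).compl₁₂ (LinearMap.proj j) (LinearMap.proj j)

theorem tracePairing_apply (K : Type*) [Field K] [∀ j, Algebra K (R j)] (a b : ∀ j, R j) :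
    tracePairing K a b = ∑ j, Algebra.trace K (R j) (a j * b j) := by
  simp [tracePairing, Algebra.traceForm_apply]

theorem tracePairing_comm (K : Type*) [Field K] [∀ j, Algebra K (R j)] (a b : ∀ j, R j) :
    tracePairing K a b = tracePairing K b a := by
  simp only [tracePairing_apply, mul_comm]

theorem eq_zero_of_forall_trace_mul {K L : Type*} [Field K] [Finite K] [Field L] [Finite L]
    [Algebra K L] {a : L} (h : ∀ b, Algebra.trace K L (b * a) = 0) : a = 0 :=
  (traceForm_nondegenerate K L).2 a h

theorem eq_zero_of_forall_tracePairing {K : Type*} [Field K] [Finite K] [∀ j, Finite (R j)]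
    [∀ j, Algebra K (R j)] {a : ∀ j, R j} (h : ∀ b, tracePairing K b a = 0) : a = 0 := by
  funext j
  refine eq_zero_of_forall_trace_mul (K := K) fun b => ?_
  have := h (Pi.single j b)
  rw [tracePairing_apply, Finset.sum_eq_single j] at this
  · simpa using this
  · intro i _ hi
    rw [Pi.single_eq_of_ne hi, zero_mul, map_zero]
  · simp

variable {p : ℕ} [Fact p.Prime]

theorem prodPairing_eq [∀ j, Algebra (ZMod p) (R j)] (a b : ∀ j, R j) :
    prodPairing p R a b = tracePairing (ZMod p) a b :=
  (tracePairing_apply _ _ _).symm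

theorem isScalarTower_zmod (K L : Type*) [Field K] [Field L] [Algebra (ZMod p) K]
    [Algebra (ZMod p) L] [Algebra K L] : IsScalarTower (ZMod p) K L :=
  IsScalarTower.of_algebraMap_eq' (Subsingleton.elim _ _)

theorem trace_tracePairing [∀ j, Finite (R j)] [∀ j, Algebra (ZMod p) (R j)] (K : Type*) [Field K]
    [Finite K] [Algebra (ZMod p) K] [∀ j, Algebra K (R j)] (a b : ∀ j, R j) :
    Algebra.trace (ZMod p) K (tracePairing K a b) = tracePairing (ZMod p) a b := by
  rw [tracePairing_apply, tracePairing_apply, map_sum]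
  refine Finset.sum_congr rfl fun j _ => ?_
  have := isScalarTower_zmod (p := p) K (R j)
  exact Algebra.trace_trace _

end Pairing

/-! ### The dual function under Condition A. -/

section Dual

variable {p : ℕ} [Fact p.Prime] {m t : ℕ} {rs : Fin t → ℕ} {M : Type*} {R : Fin t → Type*}
  [Field M] [Fintype M] [∀ j, Field (R j)] [∀ j, Fintype (R j)]
  [Algebra (ZMod p) M] [∀ j, Algebra (ZMod p) (R j)] [∀ j, Algebra M (R j)]
  {F : (∀ j, R j) → M} {ε : ℤ}

theorem ConditionA.card_eq (hF : ConditionA p m rs F ε) :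
    Fintype.card (∀ j, R j) = p ^ ∑ j, rs j := by
  rw [Fintype.card_pi, Finset.prod_congr rfl fun j _ => hF.card_R j, Finset.prod_pow_eq_pow_sum]

theorem ConditionA.eq_zero_of_neg_eq (hF : ConditionA p m rs F ε) {x : ∀ j, R j} (hx : -x = x) :
    x = 0 := by
  funext j
  have hxj : x j + x j = 0 := by
    have := congrFun hx j
    rw [Pi.neg_apply] at this
    nth_rewrite 1 [← this]
    exact neg_add_cancel _
  have hchar : CharP (R j) p :=
    charP_of_injective_algebraMap (algebraMap (ZMod p) (R j)).injective p
  obtain ⟨k, hk⟩ := hF.odd_p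
  have hp0 := CharP.cast_eq_zero (R j) p
  rw [hk] at hp0
  push_cast at hp0
  rw [Pi.zero_apply]
  linear_combination x j * hp0 - k * hxj

/-- The Walsh transforms of the components of `F`, in terms of a function `Fs` that vanishes
at `0`. -/
theorem ConditionA.exists_dual (hF : ConditionA p m rs F ε) :
    ∃ (Fs : (∀ j, R j) → M) (e : ℕ), 0 < e ∧ (∀ a b : M, a ^ e = b ^ e → a = b) ∧ Fs 0 = 0 ∧
      ∀ c : M, c ≠ 0 → ∀ a, walsh p (prodPairing p R) (component p (fieldPairing p M) F c) a =
        ε * (p ^ ((∑ j, rs j) / 2) : ℕ) *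
          ZMod.stdAddChar (Algebra.trace (ZMod p) M ((c ^ e)⁻¹ * Fs a)) := by
  obtain ⟨Fs, e, σ, he, -, ⟨-, -, hdual⟩, hσ, -⟩ := hF.dual
  have hwalsh : ∀ c : M, c ≠ 0 → ∀ a,
      walsh p (prodPairing p R) (component p (fieldPairing p M) F c) a =
        ε * (p ^ ((∑ j, rs j) / 2) : ℕ) *
          ZMod.stdAddChar (Algebra.trace (ZMod p) M ((c ^ e)⁻¹ * Fs a)) := by
    intro c hc a
    rw [(hdual ⟨c, hc⟩).walsh_eq hF.odd_p hF.even_r hF.sign (hF.weaklyRegular c hc) a,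
      component, fieldPairing, hσ]
  refine ⟨Fs, e, he, ?_, ?_, hwalsh⟩
  · intro a b hab
    by_cases ha : a = 0
    · subst ha
      rw [zero_pow he.ne', eq_comm, pow_eq_zero_iff he.ne'] at hab
      exact hab.symm
    by_cases hb : b = 0
    · subst hb
      rw [zero_pow he.ne'] at hab
      exact absurd (pow_eq_zero_iff he.ne' |>.1 hab) ha
    have : σ ⟨a, ha⟩ = σ ⟨b, hb⟩ := Subtype.ext (by rw [hσ, hσ]; simp only [hab])
    exact congrArg Subtype.val (σ.injective this)
  -- Every nonzero `b` is some `(c ^ e)⁻¹` since `σ` is onto, so it suffices to show that the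
  -- exponent in the Walsh coefficient of `F_c` at `0` vanishes.
  · refine eq_zero_of_forall_trace_mul (K := ZMod p) fun b => ?_
    by_cases hb : b = 0
    · rw [hb, zero_mul, _root_.map_zero]
    obtain ⟨⟨c, hc⟩, hcb⟩ := σ.surjective ⟨b, hb⟩
    have hcb' : (c ^ e)⁻¹ = b := by rw [← hσ ⟨c, hc⟩, hcb]
    rw [← hcb']
    refine eq_zero_of_sum_eq (f := component p (fieldPairing p M) F c) hF.odd_p
      (fun _ => hF.eq_zero_of_neg_eq) ?_ ?_ hF.sign
      (P := p ^ ((∑ j, rs j) / 2)) hF.odd_p.pow ?_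
    · simp [component, fieldPairing, hF.map_zero]
    · intro x
      simp [component, hF.map_neg]
    · rw [← hwalsh c hc 0]
      simp [walsh, prodPairing_eq]

end Dual

/-! ### Counting zeros of `Tr(lam * F)` orthogonal to a subspace. -/

section Counting

variable {p : ℕ} [Fact p.Prime] {m t : ℕ} {rs : Fin t → ℕ}
  {K₁ K₂ M : Type*} {R : Fin t → Type*}
  [Field K₁] [Fintype K₁] [Field K₂] [Fintype K₂] [Field M] [Fintype M]
  [∀ j, Field (R j)] [∀ j, Fintype (R j)]
  [Algebra (ZMod p) M] [∀ j, Algebra (ZMod p) (R j)]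
  [Algebra (ZMod p) K₁] [Algebra (ZMod p) K₂]
  [Algebra K₂ M] [∀ j, Algebra K₁ (R j)]
  {F : (∀ j, R j) → M} {ε : ℤ}

theorem forall_trace_mul_eq_zero_iff {K L : Type*} [Field K] [Finite K] [Field L] [Finite L]
    [Algebra (ZMod p) K] [Algebra (ZMod p) L] [Algebra K L] (a : L) :
    (∀ y : K, Algebra.trace (ZMod p) L (algebraMap K L y * a) = 0) ↔ Algebra.trace K L a = 0 := by
  have := isScalarTower_zmod (p := p) K L
  have h : ∀ y : K, Algebra.trace (ZMod p) L (algebraMap K L y * a) =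
      Algebra.trace (ZMod p) K (y * Algebra.trace K L a) := by
    intro y
    rw [← Algebra.trace_trace (S := K), ← Algebra.smul_def, map_smul, smul_eq_mul]
  simp only [h]
  exact ⟨fun h => eq_zero_of_forall_trace_mul h, fun h y => by rw [h, mul_zero, map_zero]⟩

/-- `U` is stable under `K₁`, so scaling `u` and nondegeneracy of the trace recover the `K₁`-valued
pairing; thus characters of `𝔽_p` detect orthogonality over `K₁`. -/
theorem forall_tracePairing_zmod_iff (U : Submodule K₁ (∀ j, R j)) (x : ∀ j, R j) :
    (∀ u ∈ U, tracePairing (ZMod p) u x = 0) ↔ ∀ u ∈ U, tracePairing K₁ u x = 0 := by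
  constructor
  · intro h u hu
    refine eq_zero_of_forall_trace_mul (K := ZMod p) fun c => ?_
    have := h (c • u) (U.smul_mem c hu)
    rwa [← trace_tracePairing K₁, map_smul, LinearMap.smul_apply, smul_eq_mul] at this
  · intro h u hu
    rw [← trace_tracePairing K₁, h u hu, map_zero]

open Classical in
theorem sum_stdAddChar_trace_mul (K : Type*) {L : Type*} [Field K] [Fintype K] [Field L] [Finite L]
    [Algebra (ZMod p) K] [Algebra (ZMod p) L] [Algebra K L] (a : L) :
    ∑ y : K, (ZMod.stdAddChar (Algebra.trace (ZMod p) L (algebraMap K L y * a)) : ℂ) =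
      if Algebra.trace K L a = 0 then (Fintype.card K : ℂ) else 0 := by
  let g : K →+ ZMod p :=
    (Algebra.trace (ZMod p) L).toAddMonoidHom.comp
      ((AddMonoidHom.mulRight a).comp (algebraMap K L).toAddMonoidHom)
  exact sum_stdAddChar_comp g (forall_trace_mul_eq_zero_iff (p := p) (K := K) a)

open Classical in
/-- The number of zeros of `Tr(lam * F)` orthogonal to a subspace `U`, in terms of the number of
zeros in `U` of a trace of the dual function. -/
theorem card_zeros_inter_orthogonal {Fs : (∀ j, R j) → M} {e : ℕ} (he : 0 < e)
    (hinj : ∀ a b : M, a ^ e = b ^ e → a = b) {P : ℕ}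
    (hcard : Fintype.card (∀ j, R j) = P ^ 2)
    (hwalsh : ∀ c : M, c ≠ 0 → ∀ a,
      walsh p (prodPairing p R) (component p (fieldPairing p M) F c) a =
        ε * P * ZMod.stdAddChar (Algebra.trace (ZMod p) M ((c ^ e)⁻¹ * Fs a)))
    {lam : M} (hlam : lam ≠ 0) (U : Submodule K₁ (∀ j, R j)) :
    (Fintype.card K₂ * Nat.card U *
      Finset.card {x | Algebra.trace K₂ M (lam * F x) = 0 ∧ ∀ u ∈ U, tracePairing K₁ u x = 0} : ℤ) =
    P ^ 2 + ε * P * (Fintype.card K₂ *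
      Finset.card {u | u ∈ U ∧ Algebra.trace K₂ M ((lam ^ e)⁻¹ * Fs u) = 0} - Nat.card U) := by
  -- The indicator of the set to be counted, as a product of two character sums.
  have hx : ∀ x : ∀ j, R j,
      (∑ y : K₂, (ZMod.stdAddChar (Algebra.trace (ZMod p) M (algebraMap K₂ M y * (lam * F x))) : ℂ)) *
        ∑ u : U, ZMod.stdAddChar (-tracePairing (ZMod p) u.1 x) =
      if Algebra.trace K₂ M (lam * F x) = 0 ∧ ∀ u ∈ U, tracePairing K₁ u x = 0
        then (Fintype.card K₂ * Nat.card U : ℂ) else 0 := by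
    intro x
    let g : U →+ ZMod p :=
      -((tracePairing (ZMod p)).flip x).toAddMonoidHom.comp U.subtype.toAddMonoidHom
    have hg : (∀ u, g u = 0) ↔ ∀ u ∈ U, tracePairing K₁ u x = 0 := by
      rw [← forall_tracePairing_zmod_iff (p := p)]
      simp [g]
    have h := sum_stdAddChar_comp g hg
    rw [sum_stdAddChar_trace_mul]
    change _ * ∑ u : U, (ZMod.stdAddChar (g u) : ℂ) = _
    rw [h, Nat.card_eq_fintype_card, ite_zero_mul_ite_zero]
  have hsum := Finset.sum_congr rfl fun x (_ : x ∈ (Finset.univ : Finset (∀ j, R j))) => hx x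
  rw [← Finset.sum_filter, Finset.sum_const, nsmul_eq_mul] at hsum
  -- The term `y = 0` is the sum of a linear character over `V`, equal to `P ^ 2` at `u = 0` and
  -- zero elsewhere; the terms `y ≠ 0` come from the dual function.
  have hu : ∀ u : ∀ j, R j, ∑ y : K₂,
      walsh p (prodPairing p R) (component p (fieldPairing p M) F (algebraMap K₂ M y * lam)) u =
      (if u = 0 then (P : ℂ) ^ 2 else 0) + ε * P * ((Fintype.card K₂ : ℂ) *
        (if Algebra.trace K₂ M ((lam ^ e)⁻¹ * Fs u) = 0 then 1 else 0) - 1) := by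
    intro u
    -- This permutes `K₂` and fixes `0` (as `0⁻¹ = 0`), so the sum over `y` again becomes an
    -- indicator.
    let τ : K₂ → K₂ := fun y => (y ^ e)⁻¹
    have hτ : Function.Bijective τ := by
      refine Finite.injective_iff_bijective.1 fun a b h => (algebraMap K₂ M).injective ?_
      apply hinj
      rw [← map_pow, ← map_pow, inv_injective h]
    have hτ0 : τ 0 = 0 := by simp [τ, he.ne']
    have hs := sum_stdAddChar_trace_mul (p := p) K₂ ((lam ^ e)⁻¹ * Fs u)
    rw [← hτ.sum_comp, ← Finset.add_sum_erase _ _ (Finset.mem_univ (0 : K₂)), hτ0, map_zero,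
      zero_mul, map_zero, AddChar.map_zero_eq_one] at hs
    rw [← Finset.add_sum_erase _ _ (Finset.mem_univ (0 : K₂)), mul_ite, mul_one, mul_zero, ← hs,
      add_sub_cancel_left, Finset.mul_sum]
    congr 1
    · rw [map_zero, zero_mul, walsh]
      let g : (∀ j, R j) →+ ZMod p := -(tracePairing (ZMod p) u).toAddMonoidHom
      have hg : (∀ x, g x = 0) ↔ u = 0 := by
        constructor
        · intro h
          refine eq_zero_of_forall_tracePairing (K := ZMod p) fun b => ?_
          rw [tracePairing_comm]
          simpa [g] using h b
        · rintro rfl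
          simp [g]
      have h := sum_stdAddChar_comp g hg
      rw [hcard] at h
      push_cast at h
      rw [← h]
      refine Finset.sum_congr rfl fun x _ => ?_
      simp [component, fieldPairing, prodPairing_eq, g]
    · refine Finset.sum_congr rfl fun y hy => ?_
      have hy0 : algebraMap K₂ M y ≠ 0 :=
        (map_ne_zero _).2 (Finset.ne_of_mem_erase hy)
      rw [hwalsh _ (mul_ne_zero hy0 hlam), mul_pow, mul_inv, mul_assoc _ _ (Fs u)]
      simp only [τ, map_inv₀, map_pow]
  have hswap : ∑ x : ∀ j, R j,
      (∑ y : K₂, (ZMod.stdAddChar (Algebra.trace (ZMod p) M (algebraMap K₂ M y * (lam * F x))) : ℂ)) *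
        ∑ u : U, ZMod.stdAddChar (-tracePairing (ZMod p) u.1 x) =
      ∑ u : U, ∑ y : K₂,
        walsh p (prodPairing p R) (component p (fieldPairing p M) F (algebraMap K₂ M y * lam)) u := by
    simp only [walsh, component, fieldPairing, prodPairing_eq, sub_eq_add_neg, Finset.sum_mul_sum,
      mul_assoc, AddChar.map_add_eq_mul]
    rw [Finset.sum_comm]
    rw [Finset.sum_congr rfl fun y _ => Finset.sum_comm]
    exact Finset.sum_comm
  rw [hswap, Finset.sum_congr rfl fun u _ => hu u.1, Finset.sum_add_distrib, ← Finset.mul_sum,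
    Finset.sum_sub_distrib, ← Finset.mul_sum, Finset.sum_boole] at hsum
  have h0 : ∑ u : U, (if u.1 = 0 then (P : ℂ) ^ 2 else 0) = (P : ℂ) ^ 2 := by
    simp
  rw [h0, Finset.sum_const, Finset.card_univ, nsmul_eq_mul, mul_one,
    ← Nat.card_eq_fintype_card (α := U)] at hsum
  have hU : Finset.card {u : U | Algebra.trace K₂ M ((lam ^ e)⁻¹ * Fs u) = 0} =
      Finset.card {u | u ∈ U ∧ Algebra.trace K₂ M ((lam ^ e)⁻¹ * Fs u) = 0} := by
    rw [← Finset.card_map (Function.Embedding.subtype _)]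
    congr 1
    ext u
    simp [and_comm]
  rw [← hU]
  have h := hsum.symm
  rw [mul_comm] at h
  have hZ : ((Fintype.card K₂ * Nat.card U * Finset.card
      {x | Algebra.trace K₂ M (lam * F x) = 0 ∧ ∀ u ∈ U, tracePairing K₁ u x = 0} : ℤ) : ℂ) =
    ((P ^ 2 + ε * P * (Fintype.card K₂ *
      Finset.card {u : U | Algebra.trace K₂ M ((lam ^ e)⁻¹ * Fs u) = 0} - Nat.card U) : ℤ) : ℂ) := by
    push_cast
    convert h
  exact_mod_cast hZ

end Counting

/-! ### Separating non-proportional vectors by the defining set. -/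

section Separation

/-- Comparison of the numbers of zeros orthogonal to a subspace with `u` elements and to one
with `q₁ * u` elements. -/
theorem zeros_lt_zeros {q₁ q₂ P ε u u' H H' N N' : ℤ} (hq₁ : 1 < q₁) (hq₂ : 0 < q₂)
    (hε : ε = 1 ∨ ε = -1) (hP : q₁ * q₂ ≤ P) (hP' : ε = -1 → q₁ * q₂ < P)
    (hN : q₂ * u * N = P ^ 2 + ε * P * (q₂ * H - u))
    (hN' : q₂ * u' * N' = P ^ 2 + ε * P * (q₂ * H' - u')) (hu : 0 < u) (huu' : u' = q₁ * u)
    (huq : u ≤ q₁) (hH : 1 ≤ H) (hHu : H ≤ u) (hHH' : H ≤ H') (hdiff : u - H ≤ u' - H') :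
    N' < N := by
  have hP0 : 0 < P := (mul_pos (by linarith) hq₂).trans_le hP
  have key : 0 < (q₁ - 1) * P + ε * q₂ * (q₁ * H - H') := by
    have hq : 0 < q₁ - 1 := by linarith
    rcases hε with rfl | rfl
    -- For sign `1`, `H ≥ 1` leaves a surplus `(q₁ - 1) * q₂`, so `P = q₁ * q₂` is allowed; for sign
    -- `-1` the bound below has no slack and strictness comes from `P`.
    · have h1 : (q₁ - 1) * (1 - q₁) ≤ q₁ * H - H' := by
        have : (q₁ - 1) * (1 - q₁) ≤ (q₁ - 1) * (H - u) :=
          mul_le_mul_of_nonneg_left (by linarith) hq.le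
        rw [huu'] at hdiff
        linarith
      have h2 := mul_le_mul_of_nonneg_left h1 hq₂.le
      have h3 := mul_le_mul_of_nonneg_left hP hq.le
      have h4 := mul_pos hq hq₂
      linarith
    · have h1 : q₁ * H - H' ≤ (q₁ - 1) * q₁ := by
        have : (q₁ - 1) * H ≤ (q₁ - 1) * q₁ := mul_le_mul_of_nonneg_left (by linarith) hq.le
        linarith
      have h2 := mul_le_mul_of_nonneg_left h1 hq₂.le
      have h3 := mul_lt_mul_of_pos_left (hP' rfl) hq
      linarith
  have h : q₂ * u' * (N - N') = P * ((q₁ - 1) * P + ε * q₂ * (q₁ * H - H')) := by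
    rw [mul_sub, hN', huu', show q₂ * (q₁ * u) * N = q₁ * (q₂ * u * N) by ring, hN]
    ring
  have hu' : 0 < q₂ * u' := by
    rw [huu']
    exact mul_pos hq₂ (mul_pos (by linarith) hu)
  have := pos_of_mul_pos_right (h ▸ mul_pos hP0 key) hu'.le
  linarith

/-- Only an inequality, because `b = 0` is allowed. -/
theorem card_span_singleton_le {K V : Type*} [Field K] [Fintype K] [AddCommGroup V] [Module K V]
    [Finite V] (b : V) : Nat.card (Submodule.span K {b}) ≤ Fintype.card K := by
  have h : Module.finrank K (Submodule.span K {b}) ≤ 1 :=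
    (finrank_span_le_card ({b} : Set V)).trans (by simp)
  rw [Module.natCard_eq_pow_finrank (K := K), Nat.card_eq_fintype_card]
  exact (Nat.pow_le_pow_right Fintype.card_pos h).trans (pow_one _).le

theorem card_sup_span_singleton {K V : Type*} [Field K] [Fintype K] [AddCommGroup V] [Module K V]
    [Finite V] {U : Submodule K V} {a : V} (ha : a ∉ U) :
    Nat.card (U ⊔ Submodule.span K {a} : Submodule K V) = Fintype.card K * Nat.card U := by
  have ha0 : a ≠ 0 := fun h => ha (h ▸ U.zero_mem)
  have hinf : U ⊓ Submodule.span K {a} = ⊥ :=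
    disjoint_iff.1 ((Submodule.disjoint_span_singleton' ha0).2 ha)
  have h := Submodule.finrank_sup_add_finrank_inf_eq U (Submodule.span K {a})
  rw [hinf, finrank_bot, add_zero, finrank_span_singleton ha0] at h
  rw [Module.natCard_eq_pow_finrank (K := K), Module.natCard_eq_pow_finrank (K := K) (V := U), h,
    Nat.card_eq_fintype_card, pow_succ']

variable {t : ℕ} {R : Fin t → Type*} [∀ j, Field (R j)]

/-- Any `α` that is not a multiple of `β` is separated from it by an element of `E`. -/
def Separates (K : Type*) [Field K] [∀ j, Algebra K (R j)] (E : Finset (∀ j, R j)) : Prop :=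
  ∀ α β : ∀ j, R j, α ∉ Submodule.span K {β} →
    ∃ d ∈ E, tracePairing K β d = 0 ∧ tracePairing K α d ≠ 0

-- If separation failed, every zero orthogonal to `β` would be orthogonal to `α`, contradicting the
-- strict drop in `zeros_lt_zeros`. The case `β = 0` is included and later yields injectivity of the
-- encoding.
open Classical in
theorem separates_defSet {p : ℕ} [Fact p.Prime] {m s₁ s₂ : ℕ} {rs : Fin t → ℕ}
    {K₁ K₂ M : Type*} [Field K₁] [Fintype K₁] [Field K₂] [Fintype K₂] [Field M] [Fintype M]
    [∀ j, Fintype (R j)] [Algebra (ZMod p) M] [∀ j, Algebra (ZMod p) (R j)]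
    [Algebra (ZMod p) K₁] [Algebra (ZMod p) K₂]
    [Algebra K₂ M] [∀ j, Algebra M (R j)] [∀ j, Algebra K₁ (R j)]
    {F : (∀ j, R j) → M} {ε : ℤ} (hF : ConditionA p m rs F ε)
    (hK₁ : Fintype.card K₁ = p ^ s₁) (hK₂ : Fintype.card K₂ = p ^ s₂) {lam : M} (hlam : lam ≠ 0)
    (hle : s₁ + s₂ ≤ (∑ j, rs j) / 2) (hne : ε = -1 → s₁ + s₂ ≠ (∑ j, rs j) / 2) :
    Separates K₁ (defSet K₂ F lam) := by
  intro α β hα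
  by_contra! hsep
  obtain ⟨Fs, e, he, hinj, hFs0, hwalsh⟩ := hF.exists_dual
  have hcard : Fintype.card (∀ j, R j) = (p ^ ((∑ j, rs j) / 2)) ^ 2 := by
    rw [hF.card_eq, ← pow_mul, Nat.div_mul_cancel hF.even_r.two_dvd]
  set U := Submodule.span K₁ {β}
  set U' := U ⊔ Submodule.span K₁ {α}
  have hUU' : U ≤ U' := le_sup_left
  have hN := card_zeros_inter_orthogonal (K₂ := K₂) he hinj hcard hwalsh hlam U
  have hN' := card_zeros_inter_orthogonal (K₂ := K₂) he hinj hcard hwalsh hlam U'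
  -- Both the zeros and the nonzeros of the dual trace can only increase from `U` to `U'`; the
  -- latter gives `u - H ≤ u' - H'`.
  have hsplit : ∀ W : Submodule K₁ (∀ j, R j),
      Finset.card {u | u ∈ W ∧ Algebra.trace K₂ M ((lam ^ e)⁻¹ * Fs u) = 0} +
      Finset.card {u | u ∈ W ∧ ¬ Algebra.trace K₂ M ((lam ^ e)⁻¹ * Fs u) = 0} = Nat.card W := by
    intro W
    rw [← Finset.filter_filter, ← Finset.filter_filter, Finset.card_filter_add_card_filter_not,
      Nat.card_eq_fintype_card, Fintype.card_subtype]
  have hmono : ∀ (q : (∀ j, R j) → Prop) [DecidablePred q], Finset.card {u | u ∈ U ∧ q u} ≤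
      Finset.card {u | u ∈ U' ∧ q u} := fun q _ =>
    Finset.card_le_card (Finset.monotone_filter_right _ fun u _ hu => ⟨hUU' hu.1, hu.2⟩)
  have hH : 1 ≤ Finset.card {u | u ∈ U ∧ Algebra.trace K₂ M ((lam ^ e)⁻¹ * Fs u) = 0} := by
    refine Finset.card_pos.2 ⟨0, ?_⟩
    simp [hFs0]
  have h1 := hsplit U
  have h2 := hsplit U'
  have h3 := hmono fun u => Algebra.trace K₂ M ((lam ^ e)⁻¹ * Fs u) = 0
  have h4 := hmono fun u => ¬ Algebra.trace K₂ M ((lam ^ e)⁻¹ * Fs u) = 0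
  have hp1 : 1 < p := Nat.Prime.one_lt Fact.out
  have hq : Fintype.card K₁ * Fintype.card K₂ = p ^ (s₁ + s₂) := by
    rw [hK₁, hK₂, pow_add]
  have hlt := zeros_lt_zeros (q₁ := Fintype.card K₁) (q₂ := Fintype.card K₂)
    (P := (p ^ ((∑ j, rs j) / 2) : ℕ)) (by exact_mod_cast Fintype.one_lt_card)
    (by exact_mod_cast Fintype.card_pos) hF.sign
    (by exact_mod_cast hq.trans_le (Nat.pow_le_pow_right hp1.le hle))
    (fun hε => by
      exact_mod_cast hq.trans_lt (Nat.pow_lt_pow_right hp1 (lt_of_le_of_ne hle (hne hε))))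
    hN hN' (by exact_mod_cast Nat.card_pos) (by exact_mod_cast card_sup_span_singleton hα)
    (by exact_mod_cast card_span_singleton_le β) (by exact_mod_cast hH) (by omega)
    (by exact_mod_cast h3) (by omega)
  refine absurd hlt (not_lt.2 ?_)
  norm_cast
  refine Finset.card_le_card (Finset.monotone_filter_right _ fun x _ hx => ⟨hx.1, fun u hu => ?_⟩)
  obtain ⟨v, hv, w, hw, rfl⟩ := Submodule.mem_sup.1 hu
  obtain ⟨c, rfl⟩ := Submodule.mem_span_singleton.1 hw
  have hβx := hx.2 β (Submodule.mem_span_singleton_self β)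
  have hαx : tracePairing K₁ α x = 0 := by
    by_cases hx0 : x = 0
    · rw [hx0, _root_.map_zero]
    · exact hsep x (by simp [defSet, hx0, hx.1]) hβx
  rw [map_add, map_smul, LinearMap.add_apply, LinearMap.smul_apply, hx.2 v hv, hαx, smul_zero,
    add_zero]

end Separation

/-! ### From separation to properties of the codes. -/

section DefiningSets

variable {t : ℕ} {R : Fin t → Type*} [∀ j, Field (R j)] {K : Type*} [Field K]
  [∀ j, Algebra K (R j)] {D E : Finset (∀ j, R j)}

theorem codeword_apply (α : ∀ j, R j) (d : E) : codeword K E α d = tracePairing K α d.1 :=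
  (tracePairing_apply _ _ _).symm

theorem Separates.codeword_injective (hE : Separates K E) : Function.Injective (codeword K E) := by
  rw [injective_iff_map_eq_zero]
  intro α hα
  by_contra h
  obtain ⟨d, hd, -, hne⟩ := hE α 0 (by simpa using h)
  exact hne (by rw [← codeword_apply α ⟨d, hd⟩, hα, Pi.zero_apply])

theorem Separates.card_code (hE : Separates K E) : Nat.card (code K E) = Nat.card (∀ j, R j) :=
  (Nat.card_congr (LinearEquiv.ofInjective _ hE.codeword_injective).toEquiv).symm

/-- A separating point lies in the support of `α` but not of `β`, and it is not `i₀`, where `β` has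
coordinate `1`. Proportional words agreeing at `i₀` are equal. -/
theorem Separates.isMinimalAt (hE : Separates K E) (i₀ : E) : IsMinimalAt (code K E) i₀ := by
  rintro _ ⟨α, rfl⟩ _ ⟨β, rfl⟩ h1 h1' hsub
  by_cases h : α ∈ Submodule.span K {β}
  · obtain ⟨a, rfl⟩ := Submodule.mem_span_singleton.1 h
    rw [map_smul, Pi.smul_apply, h1', smul_eq_mul, mul_one] at h1
    rw [h1, one_smul]
  · exfalso
    obtain ⟨d, hd, h0, hne⟩ := hE α β h
    rw [← codeword_apply β ⟨d, hd⟩] at h0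
    rw [← codeword_apply α ⟨d, hd⟩] at hne
    have hi : (⟨d, hd⟩ : E) ≠ i₀ := by
      rintro rfl
      rw [h1'] at h0
      exact one_ne_zero h0
    let i : Participant i₀ := ⟨⟨d, hd⟩, hi⟩
    have hmem : i ∈ participantSupport i₀ (codeword K E α) := mem_participantSupport.2 hne
    exact mem_participantSupport.1 (hsub hmem) h0

theorem Separates.of_isProjectiveSystem (hD : Separates K D) (h : IsProjectiveSystem K D E) :
    Separates K E := by
  intro α β hαβ
  obtain ⟨d, hd, h0, hne⟩ := hD α β hαβ
  have hd' : d ∈ (D : Set (∀ j, R j)) := hd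
  rw [h.2.1] at hd'
  simp only [Set.mem_iUnion] at hd'
  obtain ⟨w, hw, c, hc, rfl⟩ := hd'
  rw [map_smul, smul_eq_mul] at h0 hne
  exact ⟨w, hw, (mul_eq_zero.1 h0).resolve_left hc, right_ne_zero_of_mul hne⟩

/-- By nondegeneracy of the pairing, dual words are exactly the linear relations among the points of
`E`. -/
theorem mem_dualCode_code_iff [Finite K] [∀ j, Finite (R j)] (u : E → K) :
    u ∈ dualCode (code K E) ↔ ∑ d, u d • d.1 = 0 := by
  have h : ∀ α, u ⬝ᵥ codeword K E α = tracePairing K α (∑ d, u d • d.1) := by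
    intro α
    rw [map_sum, dotProduct]
    exact Finset.sum_congr rfl fun d _ => by rw [map_smul, codeword_apply, smul_eq_mul]
  constructor
  · intro hu
    exact eq_zero_of_forall_tracePairing (K := K) fun α => by rw [← h]; exact hu _ ⟨α, rfl⟩
  · rintro hu _ ⟨α, rfl⟩
    rw [h, hu, map_zero]

theorem eq_zero_of_mem_dualCode_of_support_singleton [Finite K] [∀ j, Finite (R j)]
    (hE : (0 : ∀ j, R j) ∉ E) {u : E → K} (hu : u ∈ dualCode (code K E)) {i : E}
    (hi : ∀ d, d ≠ i → u d = 0) : u = 0 := by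
  rw [mem_dualCode_code_iff, Finset.sum_eq_single i (fun d _ hd => by rw [hi d hd, zero_smul])
    (fun h => absurd (Finset.mem_univ i) h)] at hu
  have hne : i.1 ≠ 0 := fun h => hE (h ▸ i.2)
  have hui := (smul_eq_zero.1 hu).resolve_right hne
  funext d
  by_cases hd : d = i
  · rw [hd, hui, Pi.zero_apply]
  · exact hi d hd

theorem eq_zero_of_mem_dualCode_of_support_pair [Finite K] [∀ j, Finite (R j)]
    (hE : (0 : ∀ j, R j) ∉ E) {u : E → K} (hu : u ∈ dualCode (code K E)) {i j : E} (hij : i ≠ j)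
    (hmul : ¬ ∃ c : K, i.1 = c • j.1) (hd : ∀ d, d ≠ i → d ≠ j → u d = 0) : u = 0 := by
  classical
  have hui : u i = 0 := by
    by_contra hne
    rw [mem_dualCode_code_iff, Finset.sum_eq_add i j hij
      (fun d _ h => by rw [hd d h.1 h.2, zero_smul]) (fun h => absurd (Finset.mem_univ i) h)
      (fun h => absurd (Finset.mem_univ j) h)] at hu
    refine hmul ⟨-((u i)⁻¹ * u j), ?_⟩
    rw [neg_smul, mul_smul, ← smul_neg, eq_inv_smul_iff₀ hne]
    exact eq_neg_of_add_eq_zero_left hu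
  refine eq_zero_of_mem_dualCode_of_support_singleton hE hu (i := j) fun d h => ?_
  by_cases hdi : d = i
  · rw [hdi, hui]
  · exact hd d hdi h

theorem two_le_hammingNorm [DecidableEq K] [Finite K] [∀ j, Finite (R j)]
    (hE : (0 : ∀ j, R j) ∉ E) {u : E → K} (hu : u ∈ dualCode (code K E)) (h0 : u ≠ 0) :
    2 ≤ hammingNorm u := by
  by_contra! h
  obtain ⟨i, hi⟩ := Function.ne_iff.1 h0
  refine h0 (eq_zero_of_mem_dualCode_of_support_singleton hE hu (i := i) fun d hd => ?_)
  by_contra hdu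
  exact hd (Finset.card_le_one_iff.1 (Nat.le_of_lt_succ h) (by simpa using hdu) (by simpa using hi))

theorem three_le_hammingNorm [DecidableEq K] [Finite K] [∀ j, Finite (R j)]
    (hE : (0 : ∀ j, R j) ∉ E) (hpair : ∀ i ∈ E, ∀ j ∈ E, i ≠ j → ¬ ∃ c : K, i = c • j) {u : E → K}
    (hu : u ∈ dualCode (code K E)) (h0 : u ≠ 0) : 3 ≤ hammingNorm u := by
  classical
  by_contra! h
  obtain ⟨i, j, hij, hs⟩ := Finset.card_eq_two.1
    (le_antisymm (Nat.le_of_lt_succ h) (two_le_hammingNorm hE hu h0))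
  refine h0 (eq_zero_of_mem_dualCode_of_support_pair hE hu hij
    (hpair i i.2 j j.2 fun h => hij (Subtype.ext h)) fun d hdi hdj => ?_)
  by_contra hdu
  have : d ∈ ({i, j} : Finset E) := hs ▸ by simpa using hdu
  simp [hdi, hdj] at this

theorem IsProjectiveSystem.not_exists_smul (h : IsProjectiveSystem K D E)
    (hD : (0 : ∀ j, R j) ∉ D) :
    ∀ i ∈ E, ∀ j ∈ E, i ≠ j → ¬ ∃ c : K, i = c • j := by
  rintro i hi j hj hij ⟨c, hc⟩
  refine Set.disjoint_left.1 (h.2.2 i hi j hj hij)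
    (show i ∈ _ from ⟨1, one_ne_zero, (one_smul _ _).symm⟩)
    ⟨c, ?_, hc⟩
  rintro rfl
  rw [zero_smul] at hc
  exact hD (hc ▸ h.1 hi)

/-- Otherwise the code is the full space, of length at least `2` by the cardinality bound, and a
unit vector together with its sum with another contradicts minimality. -/
theorem Separates.exists_dualCode_ne_zero [Fintype K] [∀ j, Fintype (R j)] (hE : Separates K E)
    (hcard : Fintype.card K < Fintype.card (∀ j, R j)) : ∃ u ∈ dualCode (code K E), u ≠ 0 := by
  classical
  by_contra! hdual
  have htop : ∀ c : E → K, c ∈ code K E := fun c =>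
    mem_of_forall_dualCode fun u hu => by rw [hdual u hu, zero_dotProduct]
  have hK : Nat.card (code K E) = Fintype.card K ^ E.card := by
    rw [(Submodule.eq_top_iff'.2 htop : code K E = ⊤), Nat.card_congr Submodule.topEquiv.toEquiv,
      Nat.card_eq_fintype_card, Fintype.card_fun, Fintype.card_coe]
  rw [hE.card_code, Nat.card_eq_fintype_card] at hK
  have h2 : 1 < Fintype.card E := by
    rw [Fintype.card_coe]
    by_contra! h
    rw [hK] at hcard
    exact absurd hcard (not_lt.2 ((Nat.pow_le_pow_right Fintype.card_pos h).trans (pow_one _).le))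
  obtain ⟨i, j, hij⟩ := Fintype.one_lt_card_iff.1 h2
  have heq := hE.isMinimalAt i (Pi.single i 1) (htop _) (Pi.single i 1 + Pi.single j 1) (htop _)
    (by simp) (by simp [hij]) (fun d hd => absurd (Pi.single_eq_of_ne d.2 _)
      (mem_participantSupport.1 hd))
  have := congrFun heq j
  simp [hij.symm] at this

end DefiningSets

theorem eq_pow_sub_mul {p : ℕ} (hp : 0 < p) {N X a s r l : ℕ} (ha : a = p ^ s)
    (h : N * a ^ (l + 1) = X * p ^ r) (hle : s * (l + 1) ≤ r) :
    N = p ^ (r - s * (l + 1)) * X := by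
  rw [ha, ← pow_mul, ← Nat.sub_add_cancel hle, pow_add, ← mul_assoc] at h
  have := Nat.eq_of_mul_eq_mul_right (pow_pos hp _) h
  rw [this, mul_comm]

end BentCode

/-! ### The proposition. -/

theorem proposition4 {p : ℕ} [Fact p.Prime] {m s₁ s₂ t : ℕ} {rs : Fin t → ℕ}
    {K₁ K₂ M : Type*} {R : Fin t → Type*}
    [Field K₁] [Fintype K₁] [Field K₂] [Fintype K₂] [Field M] [Fintype M]
    [∀ j, Field (R j)] [∀ j, Fintype (R j)]
    [Algebra (ZMod p) M] [∀ j, Algebra (ZMod p) (R j)]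
    [Algebra K₁ K₂] [Algebra K₂ M] [Algebra K₁ M] [IsScalarTower K₁ K₂ M]
    [∀ j, Algebra M (R j)] [∀ j, Algebra K₁ (R j)] [∀ j, IsScalarTower K₁ M (R j)]
    (hs₁ : 0 < s₁) (hs₂ : 0 < s₂) (hs₁₂ : s₁ ∣ s₂) (hs₂m : s₂ ∣ m)
    (hK₁ : Fintype.card K₁ = p ^ s₁) (hK₂ : Fintype.card K₂ = p ^ s₂)
    (r : ℕ) (hr : r = ∑ j, rs j)
    (F : (∀ j, R j) → M) (ε : ℤ) (hF : ConditionA p m rs F ε)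
    (lam : M) (hlam : lam ≠ 0)
    (hle : s₁ + s₂ ≤ r / 2) (hne : ε = -1 → s₁ + s₂ ≠ r / 2) :
    -- the code with defining set `D(F)`
    (minDist (dualCode (code K₁ (defSet K₂ F lam))) = 2 ∧
      ∀ (k k' : ℕ) (G : Matrix (Fin k) (defSet K₂ F lam) K₁)
        (H : Matrix (Fin k') (defSet K₂ F lam) K₁),
        IsGeneratorMatrix G (code K₁ (defSet K₂ F lam)) →
        IsGeneratorMatrix H (dualCode (code K₁ (defSet K₂ F lam))) →
        ∀ i₀ : defSet K₂ F lam,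
          Set.ncard {A | IsMinimalAccessSet H i₀ A} = p ^ (r - s₁) ∧
          ∀ i : Participant i₀,
            ((∃ c : K₁, G.col i = c • G.col i₀) → ∀ A, IsMinimalAccessSet H i₀ A → i ∈ A) ∧
            ((¬ ∃ c : K₁, G.col i = c • G.col i₀) →
              numMinimalAccessSets H i₀ {i} = (p ^ s₁ - 1) * p ^ (r - 2 * s₁))) ∧
    -- the code with defining set `Dt`, for homogeneous `F`
    (∀ h : ℕ, 0 < h → (∀ c : M, c ≠ 0 → ∀ x, F (c • x) = c ^ h * F x) →
      ∀ Dt : Finset (∀ j, R j), IsProjectiveSystem K₁ (defSet K₂ F lam) Dt →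
        3 ≤ minDist (dualCode (code K₁ Dt)) ∧
        ∀ (k' : ℕ) (H : Matrix (Fin k') Dt K₁),
          IsGeneratorMatrix H (dualCode (code K₁ Dt)) →
          ∀ i₀ : Dt,
            Set.ncard {A | IsMinimalAccessSet H i₀ A} = p ^ (r - s₁) ∧
            ∀ l : ℕ, 1 ≤ l → l ≤ min (r / s₁ - 1) (minDist (dualCode (code K₁ Dt)) - 2) →
              ∀ T : Finset (Participant i₀), T.card = l →
                numMinimalAccessSets H i₀ T =
                  p ^ (r - s₁ * (l + 1)) * (p ^ s₁ - 1) ^ l) := by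
  classical
  have := charP_of_card_eq_prime_pow hK₁
  have := charP_of_card_eq_prime_pow hK₂
  let _ : Algebra (ZMod p) K₁ := ZMod.algebra K₁ p
  let _ : Algebra (ZMod p) K₂ := ZMod.algebra K₂ p
  subst hr
  have hD := separates_defSet hF hK₁ hK₂ hlam hle hne
  have hD0 : (0 : ∀ j, R j) ∉ defSet K₂ F lam := by simp [defSet]
  have hp1 : 1 < p := Nat.Prime.one_lt Fact.out
  have hs₁s₂ := Nat.le_of_dvd hs₂ hs₁₂
  have hr4 := hF.four_le
  have hcardV : Nat.card (∀ j, R j) = p ^ ∑ j, rs j := by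
    rw [Nat.card_eq_fintype_card, hF.card_eq]
  have hKV : Fintype.card K₁ < Fintype.card (∀ j, R j) := by
    rw [hF.card_eq, hK₁]
    exact Nat.pow_lt_pow_right hp1 (by omega)
  have hcount : ∀ (E : Finset (∀ j, R j)), Separates K₁ E → ∀ (k : ℕ) (H : Matrix (Fin k) E K₁),
      IsGeneratorMatrix H (dualCode (code K₁ E)) → ∀ (i₀ : E) (T : Finset (Participant i₀)),
      s₁ * (T.card + 1) ≤ ∑ j, rs j →
      (∀ u ∈ dualCode (code K₁ E), (∀ i : Participant i₀, i ∉ T → u i.1 = 0) → u = 0) →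
      numMinimalAccessSets H i₀ T =
        p ^ ((∑ j, rs j) - s₁ * (T.card + 1)) * (p ^ s₁ - 1) ^ T.card := by
    intro E hE k H hH i₀ T hT hsupp
    have h := numMinimalAccessSets_mul hH (hE.isMinimalAt i₀) T hsupp
    rw [hE.card_code, hcardV] at h
    rw [eq_pow_sub_mul (by omega) hK₁ h hT, hK₁]
  have hncard : ∀ (E : Finset (∀ j, R j)), 0 ∉ E → Separates K₁ E →
      ∀ (k : ℕ) (H : Matrix (Fin k) E K₁), IsGeneratorMatrix H (dualCode (code K₁ E)) →
      ∀ (i₀ : E), Set.ncard {A | IsMinimalAccessSet H i₀ A} = p ^ ((∑ j, rs j) - s₁) := by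
    intro E hE0 hE k H hH i₀
    rw [ncard_isMinimalAccessSet, hcount E hE k H hH i₀ ∅ (by simp; omega)
      fun u hu h => eq_zero_of_mem_dualCode_of_support_singleton hE0 hu (i := i₀) fun d hd =>
        h ⟨d, hd⟩ (Finset.notMem_empty _)]
    simp
  refine ⟨⟨?_, fun k k' G H hG hH i₀ => ⟨hncard _ hD0 hD k' H hH i₀, fun i => ⟨?_, ?_⟩⟩⟩, ?_⟩
  · obtain ⟨α, hα⟩ : ∃ α : ∀ j, R j, α ≠ 0 := by
      have : Nontrivial (∀ j, R j) :=
        Fintype.one_lt_card_iff_nontrivial.1 (lt_of_le_of_lt Fintype.card_pos hKV)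
      exact exists_ne 0
    obtain ⟨d, hd, -⟩ := hD α 0 (by simpa using hα)
    -- Evenness of `F` makes `D` symmetric, and the relation `d + (-d) = 0` is a dual word of weight
    -- `2`.
    have hnd : -d ∈ defSet K₂ F lam := by
      simpa [defSet, hF.map_neg] using hd
    have hne : (⟨-d, hnd⟩ : defSet K₂ F lam) ≠ ⟨d, hd⟩ := fun h =>
      hD0 (hF.eq_zero_of_neg_eq (congrArg Subtype.val h) ▸ hd)
    let u : defSet K₂ F lam → K₁ := Pi.single ⟨d, hd⟩ 1 + Pi.single ⟨-d, hnd⟩ 1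
    have hud : u ⟨d, hd⟩ = 1 := by simp [u, hne.symm]
    have hund : u ⟨-d, hnd⟩ = 1 := by simp [u, hne]
    have hother : ∀ x, x ≠ ⟨d, hd⟩ → x ≠ ⟨-d, hnd⟩ → u x = 0 := fun x h h' => by
      simp [u, h, h']
    have hu : u ∈ dualCode (code K₁ (defSet K₂ F lam)) := by
      rw [mem_dualCode_code_iff, Finset.sum_eq_add ⟨d, hd⟩ ⟨-d, hnd⟩ hne.symm
        (fun x _ h => by rw [hother x h.1 h.2, zero_smul])
        (fun h => absurd (Finset.mem_univ _) h) (fun h => absurd (Finset.mem_univ _) h), hud, hund]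
      simp
    have hu0 : u ≠ 0 := fun h => one_ne_zero (hud ▸ congrFun h ⟨d, hd⟩)
    refine le_antisymm ?_ (le_minDist ⟨u, hu, hu0⟩ fun v hv hv0 => two_le_hammingNorm hD0 hv hv0)
    by_contra! hlt
    refine hu0 (eq_zero_of_hammingNorm_lt_minDist hu (lt_of_le_of_lt ?_ hlt))
    rw [hammingNorm, ← Finset.card_pair hne.symm]
    refine Finset.card_le_card fun x hx => ?_
    by_contra h
    simp only [Finset.mem_insert, Finset.mem_singleton, not_or] at h
    exact (Finset.mem_filter.1 hx).2 (hother x h.1 h.2)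
  · rintro ⟨a, ha⟩ A hA
    have hmul := (col_eq_smul_iff hG _ _ _).1 ha
    obtain ⟨c, hc, h1, rfl⟩ := (isMinimalAccessSet_iff hH (hD.isMinimalAt i₀) A).1 hA
    refine mem_participantSupport.2 fun hci => hD0 ?_
    -- A zero at `i` forces the factor `a` to be `0`; then every word vanishes at `i`, so the point
    -- `i` is `0`, which is not in `D`.
    rw [hmul c hc, h1, mul_one] at hci
    have hi : i.1.1 = 0 := eq_zero_of_forall_tracePairing (K := K₁) fun b => by
      rw [← codeword_apply, hmul _ ⟨b, rfl⟩, hci, zero_mul]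
    exact hi ▸ i.1.2
  · intro hmul
    rw [hcount _ hD k' H hH i₀ {i} (by rw [Finset.card_singleton]; omega), Finset.card_singleton,
      pow_one, mul_comm, one_add_one_eq_two, mul_comm s₁]
    intro u hu hi
    refine eq_zero_of_mem_dualCode_of_support_pair hD0 hu i.2 ?_ fun d hdi hd =>
      hi ⟨d, hd⟩ fun h => hdi (congrArg Subtype.val (Finset.mem_singleton.1 h))
    rintro ⟨a, ha⟩
    refine hmul ⟨a, (col_eq_smul_iff hG _ _ _).2 ?_⟩
    rintro _ ⟨α, rfl⟩
    rw [codeword_apply, codeword_apply, ha, map_smul, smul_eq_mul]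
  · intro h _ _ Dt hDt
    have hE := hD.of_isProjectiveSystem hDt
    have hE0 : (0 : ∀ j, R j) ∉ Dt := fun h => hD0 (hDt.1 h)
    refine ⟨le_minDist (hE.exists_dualCode_ne_zero hKV) fun u hu hu0 =>
      three_le_hammingNorm hE0 (hDt.not_exists_smul hD0) hu hu0, fun k' H hH i₀ =>
      ⟨hncard _ hE0 hE k' H hH i₀, ?_⟩⟩
    rintro l hl1 hl T rfl
    refine hcount Dt hE k' H hH i₀ T ?_ fun u hu hsupp =>
      eq_zero_of_hammingNorm_lt_minDist hu ?_
    · have : T.card + 1 ≤ (∑ j, rs j) / s₁ := by omega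
      exact (Nat.mul_le_mul_left s₁ this).trans (Nat.mul_div_le _ _)
    -- The support lies in `T` and `i₀`, and `l + 1` is below the dual distance; `l ≥ 1` ensures
    -- that the subtraction of `2` is not truncated.
    · have hnorm : hammingNorm u ≤ T.card + 1 := by
        have hins := Finset.card_insert_le i₀ (T.map (Function.Embedding.subtype _))
        rw [Finset.card_map] at hins
        refine le_trans (Finset.card_le_card fun x hx => ?_) hins
        by_cases hx0 : x = i₀
        · rw [hx0]
          exact Finset.mem_insert_self _ _
        · refine Finset.mem_insert_of_mem (Finset.mem_map.2 ⟨⟨x, hx0⟩, ?_, rfl⟩)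
          by_contra hT
          exact (Finset.mem_filter.1 hx).2 (hsupp ⟨x, hx0⟩ hT)
      omega
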